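/- Let $f:\mathbb{R}^n\to\mathbb{R}^n$ be locally Lipschitz and suppose that the system $\dot x=f(x)$ is forward complete, i.e. every initial condition admits a solution on $[t_0,\infty)$. Let $r\ge 1$, let $h:\mathbb{R}^n\to\mathbb{R}$ be $r$ times differentiable, and let $\alpha_1,\dots,\alpha_r:\mathbb{R}\to\mathbb{R}$ be differentiable extended class $\mathcal K$ functions, i.e. continuous and strictly increasing with $\alpha_k(0)=0$. Put $$\psi_0=h,\qquad \psi_k(x)=\frac{\partial \psi_{k-1}}{\partial x}(x)\,f(x)+\alpha_k(\psi_{k-1}(x)),\quad 1\le k\le r,$$ where $\psi_0,\dots,\psi_{r-1}$ are assumed differentiable on $\mathbb{R}^n$, so that these functions are well defined. Let $\mathcal C:=\bigcap_{k=1}^{r}\{x\in\mathbb{R}^n:\psi_{k-1}(x)\ge 0\}$, and suppose that $h$ is a high-order barrier function of degree $r$ with these $\alpha_k$, i.e. there is an open set $\mathcal D\subset\mathbb{R}^n$ with $\mathcal C\subset\mathcal D$ and $\psi_r(x)\ge 0$ for all $x\in\mathcal D$. If $\mathcal C$ is compact, then $\mathcal C$ is asymptotically stable for $\dot x=f(x)$.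 With $\|x\|_{\mathcal C}:=\inf_{w\in\mathcal C}\|x-w\|$, this means: 1. (forward invariance) every solution that starts in $\mathcal C$ stays in $\mathcal C$ for as long as it exists; 2. (uniform stability) for every $\varepsilon>0$ there is $\delta>0$ such that, for every $t_0$ and every solution $x$ on $[t_0,\infty)$ with $\|x(t_0)\|_{\mathcal C}\le\delta$, we have $\|x(t)\|_{\mathcal C}\le\varepsilon$ for all $t\ge t_0$; 3. (attractivity) there is $\delta>0$ such that, for every $t_0$ and every solution $x$ on $[t_0,\infty)$ with $\|x(t_0)\|_{\mathcal C}\le\delta$, we have $\lim_{t\to\infty}\|x(t)\|_{\mathcal C}=0$. -/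

import Mathlib

open Set Filter Topology

noncomputable section

namespace HOBF

/-- Extended class `K` functions on the whole real line: continuous, strictly increasing,
and vanishing at `0`. -/
structure IsExtendedClassK (α : ℝ → ℝ) : Prop where
  continuous : Continuous α
  strictMono : StrictMono α
  map_zero : α 0 = 0

section System

variable {n : ℕ}

/-- The functions `ψ₀ = h`, `ψₖ = (d/dt + αₖ) ψₖ₋₁` attached to the system `ẋ = f x`, where `d/dt`
is the derivative along the system, `dψ/dt = (∂ψ/∂x) f`. The functions `α₁, α₂, …` are
`α 1, α 2, …`; the value `α 0` is not used. -/
def psi (f : EuclideanSpace ℝ (Fin n) → EuclideanSpace ℝ (Fin n))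
    (h : EuclideanSpace ℝ (Fin n) → ℝ) (α : ℕ → ℝ → ℝ) :
    ℕ → EuclideanSpace ℝ (Fin n) → ℝ
  | 0 => h
  | k + 1 => fun x => fderiv ℝ (psi f h α k) x (f x) + α (k + 1) (psi f h α k x)

/-- The set `C`, the intersection over `1 ≤ k ≤ r` of the sets `{x | 0 ≤ ψₖ₋₁ x}`. -/
def safeSet (f : EuclideanSpace ℝ (Fin n) → EuclideanSpace ℝ (Fin n))
    (h : EuclideanSpace ℝ (Fin n) → ℝ) (α : ℕ → ℝ → ℝ) (r : ℕ) :
    Set (EuclideanSpace ℝ (Fin n)) :=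
  ⋂ k ∈ Finset.Icc 1 r, {x | 0 ≤ psi f h α (k - 1) x}

/-- `h` is a high-order barrier function of degree `r` for `ẋ = f x`, with `α₁, …, αᵣ` the
extended class `K` functions and `D` the open set that witness it. -/
structure IsHOBF (f : EuclideanSpace ℝ (Fin n) → EuclideanSpace ℝ (Fin n))
    (h : EuclideanSpace ℝ (Fin n) → ℝ) (r : ℕ) (α : ℕ → ℝ → ℝ)
    (D : Set (EuclideanSpace ℝ (Fin n))) : Prop where
  one_le : 1 ≤ r
  /-- `h` is `r` times differentiable. -/
  differentiable_h : ∀ k < r, Differentiable ℝ (iteratedFDeriv ℝ k h)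
  classK : ∀ k ∈ Finset.Icc 1 r, IsExtendedClassK (α k)
  differentiable_α : ∀ k ∈ Finset.Icc 1 r, Differentiable ℝ (α k)
  /-- `ψ₁, …, ψᵣ` are well defined, since the functions that are differentiated along the system
  are differentiable. -/
  differentiable_psi : ∀ k ∈ Finset.Icc 1 r, Differentiable ℝ (psi f h α (k - 1))
  isOpen : IsOpen D
  subset : safeSet f h α r ⊆ D
  nonneg : ∀ x ∈ D, 0 ≤ psi f h α r x

/-- `ẋ = f x` is forward complete: through every initial condition there is a solution that is
defined for all future times. -/
def ForwardComplete (f : EuclideanSpace ℝ (Fin n) → EuclideanSpace ℝ (Fin n)) : Prop :=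
  ∀ (t₀ : ℝ) (x₀ : EuclideanSpace ℝ (Fin n)),
    ∃ x : ℝ → EuclideanSpace ℝ (Fin n), x t₀ = x₀ ∧ IsIntegralCurveOn x (fun _ => f) (Ici t₀)

/-- Every solution that starts in `A` stays in `A` for as long as it exists. -/
def ForwardInvariant (f : EuclideanSpace ℝ (Fin n) → EuclideanSpace ℝ (Fin n))
    (A : Set (EuclideanSpace ℝ (Fin n))) : Prop :=
  ∀ (t₀ T : ℝ) (x : ℝ → EuclideanSpace ℝ (Fin n)),
    IsIntegralCurveOn x (fun _ => f) (Ico t₀ T) → x t₀ ∈ A → ∀ t ∈ Ico t₀ T, x t ∈ A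

/-- Uniform stability of the set `A` for a forward complete system. -/
def UniformlyStable (f : EuclideanSpace ℝ (Fin n) → EuclideanSpace ℝ (Fin n))
    (A : Set (EuclideanSpace ℝ (Fin n))) : Prop :=
  ∀ ε > 0, ∃ δ > 0, ∀ (t₀ : ℝ) (x : ℝ → EuclideanSpace ℝ (Fin n)),
    IsIntegralCurveOn x (fun _ => f) (Ici t₀) → Metric.infDist (x t₀) A ≤ δ →
      ∀ t ≥ t₀, Metric.infDist (x t) A ≤ ε

/-- Attractivity of the set `A` for a forward complete system: the solutions that start in some
neighbourhood `{x | dist (x, A) ≤ δ}` converge to `A`. -/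
def Attractive (f : EuclideanSpace ℝ (Fin n) → EuclideanSpace ℝ (Fin n))
    (A : Set (EuclideanSpace ℝ (Fin n))) : Prop :=
  ∃ δ > 0, ∀ (t₀ : ℝ) (x : ℝ → EuclideanSpace ℝ (Fin n)),
    IsIntegralCurveOn x (fun _ => f) (Ici t₀) → Metric.infDist (x t₀) A ≤ δ →
      Tendsto (fun t => Metric.infDist (x t) A) atTop (𝓝 0)

/-- Asymptotic stability of a closed set `A` for a forward complete system. -/
structure AsymptoticallyStable (f : EuclideanSpace ℝ (Fin n) → EuclideanSpace ℝ (Fin n))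
    (A : Set (EuclideanSpace ℝ (Fin n))) : Prop where
  forwardInvariant : ForwardInvariant f A
  uniformlyStable : UniformlyStable f A
  attractive : Attractive f A

end System

end HOBF

end

/-!
Along a solution `x` that runs in `D`, the functions `yₖ t = ψₖ (x t)` satisfy the cascade of scalar
equations `yₖ' = yₖ₊₁ - αₖ₊₁ (yₖ)`, `k < r`, driven by `yᵣ ≥ 0`. If `yₖ₊₁ > αₖ₊₁ (-η)`, a negative
number, then `yₖ' > 0` wherever `yₖ = -η`, so `yₖ` cannot cross the level `-η` downwards.
Descending in `k` from `yᵣ ≥ 0`, this gives two facts.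

* All `yₖ` stay above `-η` if they start above a suitable `-δ` (`exists_psi_lower_bound`).
* If the solution never leaves `D`, then `liminf yₖ ≥ 0` for every `k` (`eventually_neg_le_psi`):
  below the level `-η` the derivative `yₖ'` is eventually bounded below by a positive constant, so
  that `yₖ` has to return above `-η`.

As `C` is compact, a compact neighbourhood `K` of `C` lies in `D`, and inside `K` the distance to `C`
is small as soon as all `ψₖ`, `k < r`, exceed `-η` for a small `η`
(`exists_infDist_lt_of_neg_le_psi`). The first fact then confines solutions that start near `C`
(`exists_trapping`); this is uniform stability, and, for solutions that start in `C`, forward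
invariance. In particular such solutions remain in `K ⊆ D`, so that the second fact applies and
yields attractivity.
-/

namespace HOBF

/-! ### Scalar differential inequalities -/

/-- A function whose right derivative is positive wherever it equals `m` does not fall below `m`. -/
theorem le_of_deriv_pos_at_level {y y' : ℝ → ℝ} {a b m : ℝ} (hy : ContinuousOn y (Icc a b))
    (hy' : ∀ t ∈ Ico a b, HasDerivWithinAt y (y' t) (Ici t) t) (ha : m ≤ y a)
    (hm : ∀ t ∈ Ico a b, y t = m → 0 < y' t) : ∀ t ∈ Icc a b, m ≤ y t := by
  intro t ht
  have := image_le_of_deriv_right_lt_deriv_boundary' (f := fun t => -y t) (f' := fun t => -y' t)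
    (B := fun _ => -m) (B' := fun _ => 0) hy.neg (fun t ht => (hy' t ht).neg) (neg_le_neg ha)
    continuousOn_const (fun t _ => hasDerivWithinAt_const t (Ici t) (-m))
    (fun t ht h => neg_neg_of_pos (hm t ht (neg_inj.mp h))) ht
  exact neg_le_neg_iff.mp this

/-- A function that increases at a positive minimal speed as long as it is at most `m` is
eventually at least `m`. -/
theorem eventually_le_of_deriv_ge {y y' : ℝ → ℝ} {T m c : ℝ} (hc : 0 < c)
    (hy' : ∀ t ∈ Ici T, HasDerivWithinAt y (y' t) (Ici t) t) (hy : ContinuousOn y (Ici T))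
    (hm : ∀ t ∈ Ici T, y t ≤ m → c ≤ y' t) : ∀ᶠ t in atTop, m ≤ y t := by
  obtain ⟨s, hs, hms⟩ : ∃ s ∈ Ici T, m ≤ y s := by
    by_contra! hlt
    -- By the time `b`, growth at speed `c` would bring `y` from `y T` up to `m`.
    set b := T + (m - y T) / c
    have hb : T ≤ b := le_add_of_nonneg_right
      (div_nonneg (sub_nonneg.mpr (hlt T self_mem_Ici).le) hc.le)
    have := image_le_of_deriv_right_le_deriv_boundary (a := T) (b := b)
      (f := fun t => y T + c * (t - T)) (f' := fun _ => c) (B := y) (B' := y')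
      (by fun_prop)
      (fun t _ => by simpa using
        ((((hasDerivAt_id t).sub_const T).const_mul c).const_add (y T)).hasDerivWithinAt)
      (by simp) (hy.mono Icc_subset_Ici_self) (fun t ht => hy' t ht.1)
      (fun t ht => hm t ht.1 (hlt t ht.1).le) (right_mem_Icc.mpr hb)
    have hval : y T + c * (b - T) = m := by
      simp only [b]; field_simp; ring
    exact absurd (hval ▸ this) (not_le.mpr (hlt b hb))
  filter_upwards [eventually_ge_atTop s] with t ht
  refine le_of_deriv_pos_at_level (y' := y') (a := s) (b := t)
    (hy.mono fun u hu => le_trans hs hu.1) (fun u hu => hy' u (le_trans hs hu.1)) hms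
    (fun u hu h => hc.trans_le (hm u (le_trans hs hu.1) h.le)) t (right_mem_Icc.mpr ht)

/-! ### Neighbourhoods of compact sets -/

section Metric

variable {E : Type*} [PseudoMetricSpace E] {A U : Set E}

theorem cthickening_eq_setOf_infDist_le (hA : A.Nonempty) {δ : ℝ} (hδ : 0 ≤ δ) :
    Metric.cthickening δ A = {x | Metric.infDist x A ≤ δ} := by
  ext x
  rw [Metric.mem_cthickening_iff, mem_ofPred_eq, Metric.infDist,
    ENNReal.le_ofReal_iff_toReal_le (Metric.infEDist_ne_top hA) hδ]

theorem exists_setOf_infDist_le_subset (hA : IsCompact A) (hne : A.Nonempty) (hU : IsOpen U)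
    (hAU : A ⊆ U) : ∃ δ > 0, {x | Metric.infDist x A ≤ δ} ⊆ U := by
  obtain ⟨δ, hδ, h⟩ := hA.exists_cthickening_subset_open hU hAU
  exact ⟨δ, hδ, by rwa [← cthickening_eq_setOf_infDist_le hne hδ.le]⟩

theorem isCompact_setOf_infDist_le [ProperSpace E] (hA : IsCompact A) (hne : A.Nonempty) {δ : ℝ}
    (hδ : 0 ≤ δ) : IsCompact {x | Metric.infDist x A ≤ δ} := by
  rw [← cthickening_eq_setOf_infDist_le hne hδ]
  exact hA.cthickening

end Metric

section System

variable {n : ℕ} {f : EuclideanSpace ℝ (Fin n) → EuclideanSpace ℝ (Fin n)}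
  {h : EuclideanSpace ℝ (Fin n) → ℝ} {r : ℕ} {α : ℕ → ℝ → ℝ} {D : Set (EuclideanSpace ℝ (Fin n))}

/-! ### The functions `ψₖ` and the safe set -/

theorem mem_safeSet_iff {x : EuclideanSpace ℝ (Fin n)} :
    x ∈ safeSet f h α r ↔ ∀ k < r, 0 ≤ psi f h α k x := by
  simp only [safeSet, mem_iInter, Finset.mem_Icc, mem_ofPred_eq]
  refine ⟨fun H k hk => ?_, fun H k hk => H (k - 1) (by lia)⟩
  simpa using H (k + 1) ⟨by lia, hk⟩

theorem IsHOBF.differentiable_psi_of_lt (hh : IsHOBF f h r α D) {k : ℕ} (hk : k < r) :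
    Differentiable ℝ (psi f h α k) := by
  simpa using hh.differentiable_psi (k + 1) (Finset.mem_Icc.mpr ⟨by lia, hk⟩)

theorem IsHOBF.classK_succ (hh : IsHOBF f h r α D) {k : ℕ} (hk : k < r) :
    IsExtendedClassK (α (k + 1)) :=
  hh.classK (k + 1) (Finset.mem_Icc.mpr ⟨by lia, hk⟩)

theorem IsExtendedClassK.neg_of_neg {a : ℝ → ℝ} (ha : IsExtendedClassK a) {s : ℝ} (hs : s < 0) :
    a s < 0 :=
  ha.map_zero ▸ ha.strictMono hs

theorem IsHOBF.isClosed_safeSet (hh : IsHOBF f h r α D) : IsClosed (safeSet f h α r) :=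
  isClosed_biInter fun k hk =>
    isClosed_le continuous_const (hh.differentiable_psi k hk).continuous

/-- In a compact set, a point at which all `ψₖ` are almost nonnegative is close to the safe set. -/
theorem exists_infDist_lt_of_neg_le_psi (hh : IsHOBF f h r α D)
    {K : Set (EuclideanSpace ℝ (Fin n))} (hK : IsCompact K) {ε : ℝ} (hε : 0 < ε) :
    ∃ η > 0, ∀ x ∈ K, (∀ k < r, -η ≤ psi f h α k x) →
      Metric.infDist x (safeSet f h α r) < ε := by
  have hr : (Finset.range r).Nonempty := Finset.nonempty_range_iff.mpr (by have := hh.one_le; lia)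
  set m : EuclideanSpace ℝ (Fin n) → ℝ := fun x => (Finset.range r).inf' hr fun k => psi f h α k x
  have hm : Continuous m := Continuous.finset_inf'_apply hr fun k hk =>
    (hh.differentiable_psi_of_lt (Finset.mem_range.mp hk)).continuous
  have hK' : IsCompact (K ∩ {x | ε ≤ Metric.infDist x (safeSet f h α r)}) :=
    hK.inter_right (isClosed_le continuous_const (Metric.continuous_infDist_pt _))
  rcases (K ∩ {x | ε ≤ Metric.infDist x (safeSet f h α r)}).eq_empty_or_nonempty with he | hne
  · refine ⟨1, one_pos, fun x hx _ => ?_⟩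
    by_contra! hlt
    exact (he ▸ (⟨hx, hlt⟩ : x ∈ K ∩ _) : x ∈ (∅ : Set _))
  obtain ⟨z, hz, hmax⟩ := hK'.exists_isMaxOn hne hm.continuousOn
  have hmz : m z < 0 := by
    by_contra! h0
    have hzC : z ∈ safeSet f h α r := mem_safeSet_iff.mpr fun k hk =>
      h0.trans (Finset.inf'_le _ (Finset.mem_range.mpr hk))
    exact absurd (Metric.infDist_zero_of_mem hzC ▸ hz.2 : ε ≤ 0) (not_le.mpr hε)
  refine ⟨-(m z / 2), by linarith, fun x hx hpsi => ?_⟩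
  by_contra! hlt
  have h1 : m x ≤ m z := hmax ⟨hx, hlt⟩
  have h2 : m z / 2 ≤ m x := Finset.le_inf' _ _ fun k hk => by
    simpa using hpsi k (Finset.mem_range.mp hk)
  linarith

/-- Points close to the safe set have almost nonnegative `ψₖ`. -/
theorem exists_neg_le_psi_of_infDist_le (hh : IsHOBF f h r α D)
    (hC : IsCompact (safeSet f h α r)) (hne : (safeSet f h α r).Nonempty) {η : ℝ} (hη : 0 < η) :
    ∃ δ > 0, ∀ x, Metric.infDist x (safeSet f h α r) ≤ δ → ∀ k < r, -η ≤ psi f h α k x := by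
  have hU : IsOpen (⋂ k ∈ Finset.range r, {x | -η < psi f h α k x}) :=
    isOpen_biInter_finset fun k hk => isOpen_lt continuous_const
      (hh.differentiable_psi_of_lt (Finset.mem_range.mp hk)).continuous
  obtain ⟨δ, hδ, hsub⟩ := exists_setOf_infDist_le_subset hC hne hU fun x hx => by
    simp only [mem_iInter, Finset.mem_range, mem_ofPred_eq]
    exact fun k hk => (neg_neg_of_pos hη).trans_le (mem_safeSet_iff.mp hx k hk)
  refine ⟨δ, hδ, fun x hx k hk => ?_⟩
  have := hsub hx
  simp only [mem_iInter, Finset.mem_range, mem_ofPred_eq] at this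
  exact (this k hk).le

/-! ### The cascade along a solution -/

/-- The cascade equation `yₖ' = yₖ₊₁ - αₖ₊₁ (yₖ)` for `yₖ = ψₖ ∘ x`. -/
theorem hasDerivWithinAt_psi_comp (hh : IsHOBF f h r α D) {k : ℕ} (hk : k < r)
    {x : ℝ → EuclideanSpace ℝ (Fin n)} {s : Set ℝ} (hx : IsIntegralCurveOn x (fun _ => f) s)
    {t : ℝ} (ht : t ∈ s) :
    HasDerivWithinAt (fun t => psi f h α k (x t))
      (psi f h α (k + 1) (x t) - α (k + 1) (psi f h α k (x t))) s t := by
  have := ((hh.differentiable_psi_of_lt hk) (x t)).hasFDerivAt.comp_hasDerivWithinAt t (hx t ht)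
  simpa [psi, Function.comp_def] using this

/-- Uniform lower bounds for all `ψₖ` along solutions in `D`, in terms of lower bounds at the
initial time. -/
theorem exists_psi_lower_bound (hh : IsHOBF f h r α D) {η : ℝ} (hη : 0 < η) :
    ∃ δ > 0, ∀ (a b : ℝ) (x : ℝ → EuclideanSpace ℝ (Fin n)),
      IsIntegralCurveOn x (fun _ => f) (Icc a b) → (∀ t ∈ Icc a b, x t ∈ D) →
      (∀ j < r, -δ ≤ psi f h α j (x a)) →
      ∀ j ≤ r, ∀ t ∈ Icc a b, -η ≤ psi f h α j (x t) := by
  suffices H : ∀ k ≤ r, ∀ η > 0, ∃ δ > 0, ∀ (a b : ℝ) (x : ℝ → EuclideanSpace ℝ (Fin n)),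
      IsIntegralCurveOn x (fun _ => f) (Icc a b) → (∀ t ∈ Icc a b, x t ∈ D) →
      (∀ j < r, -δ ≤ psi f h α j (x a)) →
      ∀ j, k ≤ j → j ≤ r → ∀ t ∈ Icc a b, -η ≤ psi f h α j (x t) by
    obtain ⟨δ, hδ, hb⟩ := H 0 (Nat.zero_le r) η hη
    exact ⟨δ, hδ, fun a b x hx hD ha j hj => hb a b x hx hD ha j (Nat.zero_le j) hj⟩
  intro k hk
  induction hk using Nat.decreasingInduction with
  | self =>
    intro η hη
    refine ⟨1, one_pos, fun a b x _ hD _ j hj hj' t ht => ?_⟩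
    obtain rfl := le_antisymm hj hj'
    linarith [hh.nonneg _ (hD t ht)]
  | of_succ k hk ih =>
    intro η hη
    have hα : α (k + 1) (-η) < 0 := (hh.classK_succ hk).neg_of_neg (neg_neg_of_pos hη)
    -- `ψₖ₊₁ ≥ α (-η) / 2 > α (-η)` makes the derivative of `ψₖ` positive at the level `-η`.
    obtain ⟨δ, hδ, hb⟩ := ih (min η (-α (k + 1) (-η) / 2)) (lt_min hη (by linarith))
    refine ⟨min δ η, lt_min hδ hη, fun a b x hx hD ha j hj hj' t ht => ?_⟩
    have hsucc := hb a b x hx hD fun j hj => (neg_le_neg (min_le_left _ _)).trans (ha j hj)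
    rcases hj.eq_or_lt with rfl | hlt
    · refine le_of_deriv_pos_at_level (fun t ht =>
          (hasDerivWithinAt_psi_comp hh hk hx ht).continuousWithinAt)
        (fun t ht => (hasDerivWithinAt_psi_comp hh hk hx
          (Ico_subset_Icc_self ht)).mono_of_mem_nhdsWithin (Icc_mem_nhdsGE_of_mem ht))
        ((neg_le_neg (min_le_right _ _)).trans (ha k hk)) (fun t ht heq => ?_) t ht
      have h1 := hsucc (k + 1) le_rfl hk t (Ico_subset_Icc_self ht)
      have h2 := min_le_right η (-α (k + 1) (-η) / 2)
      rw [heq]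
      linarith
    · exact (neg_le_neg (min_le_left _ _)).trans (hsucc j hlt hj' t ht)

/-- Along a solution that stays in `D` forever, every `ψₖ` has nonnegative lower limit. -/
theorem eventually_neg_le_psi (hh : IsHOBF f h r α D) {t₀ : ℝ}
    {x : ℝ → EuclideanSpace ℝ (Fin n)} (hx : IsIntegralCurveOn x (fun _ => f) (Ici t₀))
    (hD : ∀ t ∈ Ici t₀, x t ∈ D) {k : ℕ} (hk : k ≤ r) :
    ∀ η > 0, ∀ᶠ t in atTop, -η ≤ psi f h α k (x t) := by
  induction hk using Nat.decreasingInduction with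
  | self =>
    intro η hη
    filter_upwards [eventually_ge_atTop t₀] with t ht
    linarith [hh.nonneg _ (hD t ht)]
  | of_succ k hk ih =>
    intro η hη
    have hα : α (k + 1) (-η) < 0 := (hh.classK_succ hk).neg_of_neg (neg_neg_of_pos hη)
    obtain ⟨T, hT⟩ := eventually_atTop.mp (ih (-α (k + 1) (-η) / 2) (by linarith))
    have hx' : IsIntegralCurveOn x (fun _ => f) (Ici (max T t₀)) :=
      hx.mono (Ici_subset_Ici.mpr (le_max_right _ _))
    refine eventually_le_of_deriv_ge (T := max T t₀) (c := -α (k + 1) (-η) / 2) (by linarith)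
      (fun t ht => (hasDerivWithinAt_psi_comp hh hk hx' ht).mono (Ici_subset_Ici.mpr ht))
      (fun t ht => (hasDerivWithinAt_psi_comp hh hk hx' ht).continuousWithinAt)
      (fun t ht hle => ?_)
    have h1 := hT t ((le_max_left _ _).trans ht)
    have h2 := (hh.classK_succ hk).strictMono.monotone hle
    linarith

/-! ### Stability of the safe set -/

/-- Solutions that start close enough to the safe set never reach the distance `ε` from it, if
the `ε`-neighbourhood of the safe set is contained in `D`. -/
theorem exists_trapping (hh : IsHOBF f h r α D) (hC : IsCompact (safeSet f h α r))
    (hne : (safeSet f h α r).Nonempty) {ε : ℝ} (hε : 0 < ε)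
    (hεD : {x | Metric.infDist x (safeSet f h α r) ≤ ε} ⊆ D) :
    ∃ δ > 0, ∀ (a b : ℝ) (x : ℝ → EuclideanSpace ℝ (Fin n)),
      IsIntegralCurveOn x (fun _ => f) (Icc a b) →
      Metric.infDist (x a) (safeSet f h α r) ≤ δ →
      ∀ t ∈ Icc a b, Metric.infDist (x t) (safeSet f h α r) < ε := by
  obtain ⟨η, hη, hnear⟩ :=
    exists_infDist_lt_of_neg_le_psi hh (isCompact_setOf_infDist_le hC hne hε.le) hε
  obtain ⟨δ₁, hδ₁, hlow⟩ := exists_psi_lower_bound hh hη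
  obtain ⟨δ₂, hδ₂, hinit⟩ := exists_neg_le_psi_of_infDist_le hh hC hne hδ₁
  refine ⟨min δ₂ (ε / 2), lt_min hδ₂ (by linarith), fun a b x hx ha t ht => ?_⟩
  set d : ℝ → ℝ := fun t => Metric.infDist (x t) (safeSet f h α r)
  have hd : ContinuousOn d (Icc a b) :=
    (Metric.continuous_infDist_pt _).comp_continuousOn hx.continuousOn
  have hda : d a < ε := (ha.trans (min_le_right _ _)).trans_lt (by linarith)
  by_contra! hlt
  -- `s` is the first time at which the distance `ε` is attained.
  obtain ⟨s, ⟨hs, hds⟩, hleast⟩ : ∃ s, IsLeast (Icc a b ∩ d ⁻¹' {ε}) s := by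
    refine (isCompact_Icc.of_isClosed_subset
      (hd.preimage_isClosed_of_isClosed isClosed_Icc isClosed_singleton)
      inter_subset_left).exists_isLeast ?_
    obtain ⟨u, hu, hdu⟩ := intermediate_value_Icc ht.1 (hd.mono (Icc_subset_Icc_right ht.2))
      ⟨hda.le, hlt⟩
    exact ⟨u, ⟨hu.1, hu.2.trans ht.2⟩, hdu⟩
  have hle : ∀ u ∈ Icc a s, d u ≤ ε := by
    intro u hu
    by_contra! hgt
    obtain ⟨v, hv, hdv⟩ := intermediate_value_Icc hu.1
      (hd.mono (Icc_subset_Icc_right (hu.2.trans hs.2))) ⟨hda.le, hgt.le⟩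
    have hsv : s ≤ v := hleast ⟨⟨hv.1, hv.2.trans (hu.2.trans hs.2)⟩, hdv⟩
    obtain rfl : u = s := le_antisymm hu.2 (hsv.trans hv.2)
    exact hgt.ne' hds
  have hsmall : d s < ε := hnear (x s) (hle s (right_mem_Icc.mpr hs.1)) fun k hk =>
    hlow a s x (hx.mono (Icc_subset_Icc_right hs.2)) (fun u hu => hεD (hle u hu))
      (hinit (x a) (ha.trans (min_le_left _ _))) k hk.le s (right_mem_Icc.mpr hs.1)
  exact hsmall.ne hds

/-- Forward invariance is the trapping property for solutions that start at distance `0`. -/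
theorem forwardInvariant_safeSet (hh : IsHOBF f h r α D) (hC : IsCompact (safeSet f h α r))
    (hne : (safeSet f h α r).Nonempty) : ForwardInvariant f (safeSet f h α r) := by
  obtain ⟨ε₀, hε₀, hεD⟩ := exists_setOf_infDist_le_subset hC hne hh.isOpen hh.subset
  intro t₀ T x hx hx₀ t ht
  rw [hh.isClosed_safeSet.mem_iff_infDist_zero hne]
  refine le_antisymm (le_of_forall_pos_lt_add fun ε hε => ?_) Metric.infDist_nonneg
  obtain ⟨δ, hδ, htrap⟩ := exists_trapping hh hC hne (lt_min hε hε₀)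
    ((ofPred_subset_ofPred.mpr fun y hy => hy.trans (min_le_right _ _)).trans hεD)
  have := htrap t₀ t x (hx.mono (Icc_subset_Ico_right ht.2))
    ((Metric.infDist_zero_of_mem hx₀).trans_le hδ.le) t (right_mem_Icc.mpr ht.1)
  simpa using this.trans_le (min_le_left _ _)

theorem uniformlyStable_safeSet (hh : IsHOBF f h r α D) (hC : IsCompact (safeSet f h α r))
    (hne : (safeSet f h α r).Nonempty) : UniformlyStable f (safeSet f h α r) := by
  obtain ⟨ε₀, hε₀, hεD⟩ := exists_setOf_infDist_le_subset hC hne hh.isOpen hh.subset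
  intro ε hε
  obtain ⟨δ, hδ, htrap⟩ := exists_trapping hh hC hne (lt_min hε hε₀)
    ((ofPred_subset_ofPred.mpr fun y hy => hy.trans (min_le_right _ _)).trans hεD)
  exact ⟨δ, hδ, fun t₀ x hx hx₀ t ht => (htrap t₀ t x (hx.mono Icc_subset_Ici_self) hx₀ t
    (right_mem_Icc.mpr ht)).le.trans (min_le_left _ _)⟩

theorem attractive_safeSet (hh : IsHOBF f h r α D) (hC : IsCompact (safeSet f h α r))
    (hne : (safeSet f h α r).Nonempty) : Attractive f (safeSet f h α r) := by
  obtain ⟨ε₀, hε₀, hεD⟩ := exists_setOf_infDist_le_subset hC hne hh.isOpen hh.subset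
  obtain ⟨δ, hδ, htrap⟩ := exists_trapping hh hC hne hε₀ hεD
  refine ⟨δ, hδ, fun t₀ x hx hx₀ => ?_⟩
  have hK : ∀ t ∈ Ici t₀, Metric.infDist (x t) (safeSet f h α r) ≤ ε₀ := fun t ht =>
    (htrap t₀ t x (hx.mono Icc_subset_Ici_self) hx₀ t (right_mem_Icc.mpr ht)).le
  rw [tendsto_order]
  refine ⟨fun c hc => .of_forall fun t => hc.trans_le Metric.infDist_nonneg, fun ε hε => ?_⟩
  obtain ⟨η, hη, hnear⟩ :=
    exists_infDist_lt_of_neg_le_psi hh (isCompact_setOf_infDist_le hC hne hε₀.le) hε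
  have hev : ∀ᶠ t in atTop, ∀ k ∈ Finset.range r, -η ≤ psi f h α k (x t) :=
    (Finset.range r).eventually_all.mpr fun k hk =>
      eventually_neg_le_psi hh hx (fun t ht => hεD (hK t ht)) (Finset.mem_range.mp hk).le η hη
  filter_upwards [hev, eventually_ge_atTop t₀] with t hpsi ht
  exact hnear (x t) (hK t ht) fun k hk => hpsi k (Finset.mem_range.mpr hk)

end System

end HOBF

theorem proposition3 {n : ℕ}
    (f : EuclideanSpace ℝ (Fin n) → EuclideanSpace ℝ (Fin n)) (hf : LocallyLipschitz f)
    (hfc : HOBF.ForwardComplete f)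
    (h : EuclideanSpace ℝ (Fin n) → ℝ) (r : ℕ) (α : ℕ → ℝ → ℝ)
    (D : Set (EuclideanSpace ℝ (Fin n))) (hh : HOBF.IsHOBF f h r α D)
    (hC : IsCompact (HOBF.safeSet f h α r)) :
    HOBF.AsymptoticallyStable f (HOBF.safeSet f h α r) := by
  rcases (HOBF.safeSet f h α r).eq_empty_or_nonempty with he | hne
  · -- The distance to the empty set is `0` by convention.
    rw [he]
    exact ⟨fun _ _ _ _ hx => hx.elim, fun ε hε => ⟨1, one_pos, by simp [hε.le]⟩,
      ⟨1, one_pos, by simp⟩⟩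
  · exact ⟨HOBF.forwardInvariant_safeSet hh hC hne, HOBF.uniformlyStable_safeSet hh hC hne,
      HOBF.attractive_safeSet hh hC hne⟩
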